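/- **Setting.** Fix $d\in\mathbb N$. A tensor $A$ of bond dimension $D$ is a $d$-tuple $(A^1,\dots,A^d)$ of complex $D\times D$ matrices; it generates the matrix product vectors $$|V^{(N)}(A)\rangle=\sum_{i_1,\dots,i_N=1}^d \mathrm{tr}\left(A^{i_1}\cdots A^{i_N}\right)|i_1\cdots i_N\rangle\in(\mathbb C^d)^{\otimes N},\qquad N\ge 1 .$$ $A$ is called *normal* if its transfer operator $\mathcal E(X)=\sum_i A^iXA^{i\dagger}$ is primitive, that is, $\mathcal E$ has spectral radius $1$, its only eigenvalue of modulus one is $1$, this eigenvalue is nondegenerate, and the corresponding left and right eigenvectors are positive and of full rank. A *canonical form* of $A$ is a block-diagonal tensor $\bigoplus_{k=1}^r\mu_k\tilde A_k^i$ with positive numbers $\mu_k$ and normal tensors $\tilde A_k$ that generates the same vectors as $A$ for all $N\ge1$ (for example $A$ itself, if $A^i=\bigoplus_k\mu_k\tilde A_k^i$). A *basis of normal tensors* for $A$ is a finite family of normal tensors $A_j$ ($j=1,\dots,g$), of possibly different bond dimensions, such that for each $N\ge1$ the vector $|V^{(N)}(A)\rangle$ is a linear combination of the $|V^{(N)}(A_j)\rangle$,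 and there is an $N_0$ such that for all $N>N_0$ the vectors $|V^{(N)}(A_j)\rangle$, $j=1,\dots,g$, are linearly independent. **Proposition 1 (characterization of a basis of normal tensors).** Let $A$ be a tensor with canonical form $\bigoplus_{k=1}^r\mu_k\tilde A_k^i$. Normal tensors $A_j$ ($j=1,\dots,g$) form a basis of normal tensors for $A$ if and only if 1. for every $k$ there exist $j$, a non-singular matrix $X_k$ and a phase $\phi_k\in\mathbb R$ such that $\tilde A_k^i=e^{i\phi_k}X_kA_j^iX_k^{-1}$ for all $i=1,\dots,d$ (the $i$ in the exponent being the imaginary unit); and 2. the family is minimal, in the sense that for no two different indices $j\neq j'$ there are a non-singular matrix $X$ and a phase $\phi\in\mathbb R$ with $A_j^i=e^{i\phi}XA_{j'}^iX^{-1}$ for all $i$. In particular, every tensor that has a canonical form has a basis of normal tensors. -/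

import Mathlib

open scoped ComplexOrder

namespace MPV

/-- A tensor with physical dimension `d` and bond index set `n`: matrices `A¹, …, A^d`,
with rows and columns indexed by `n`. -/
abbrev Tensor (d : ℕ) (n : Type*) := Fin d → Matrix n n ℂ

/-- The matrix product vector of `A` on `N` sites, by its coefficients in the product basis:
the coefficient at `|i₁ … i_N⟩` is `tr (A^{i₁} ⋯ A^{i_N})`. -/
def mpv {d : ℕ} {n : Type*} [Fintype n] [DecidableEq n] (A : Tensor d n) (N : ℕ) :
    (Fin N → Fin d) → ℂ :=
  fun s => ((List.ofFn fun k => A (s k)).prod).trace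

/-- Two tensors, possibly of different bond dimensions, generate the same family of matrix
product vectors, on chains of every length `N ≥ 1`. -/
def SameMPV {d : ℕ} {m n : Type*} [Fintype m] [DecidableEq m] [Fintype n] [DecidableEq n]
    (A : Tensor d m) (B : Tensor d n) : Prop :=
  ∀ N : ℕ, 1 ≤ N → mpv A N = mpv B N

/-- The transfer operator `X ↦ ∑ i, A^i X (A^i)†`, a completely positive map. -/
def transferOp {d : ℕ} {n : Type*} [Fintype n] (A : Tensor d n) :
    Module.End ℂ (Matrix n n ℂ) where
  toFun X := ∑ i, A i * X * (A i).conjTranspose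
  map_add' X Y := by simp [Matrix.mul_add, Matrix.add_mul, Finset.sum_add_distrib]
  map_smul' c X := by simp [Finset.smul_sum]

/-- Primitivity of a (completely positive) map normalized to spectral radius `1`: the number `1`
is its only eigenvalue of modulus one, it is nondegenerate, and the corresponding right and left
eigenvectors are positive and of full rank. -/
structure IsPrimitive {n : Type*} [Fintype n] [DecidableEq n]
    (E : Module.End ℂ (Matrix n n ℂ)) : Prop where
  spectralRadius_eq_one : spectralRadius ℂ E = 1
  eigenvalue_eq_one : ∀ z : ℂ, E.HasEigenvalue z → ‖z‖ = 1 → z = 1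
  nondegenerate : Module.finrank ℂ (E.eigenspace 1) = 1
  right_eigenvector : ∃ ρ : Matrix n n ℂ, ρ.PosDef ∧ E ρ = ρ
  left_eigenvector : ∃ σ : Matrix n n ℂ, σ.PosDef ∧
    ∀ X : Matrix n n ℂ, (σ * E X).trace = (σ * X).trace

/-- A tensor is normal if its transfer operator is primitive. -/
def IsNormal {d : ℕ} {n : Type*} [Fintype n] [DecidableEq n] (A : Tensor d n) : Prop :=
  IsPrimitive (transferOp A)

/-- The tensor `⨁ k, μ_k A_k`: the matrices are block diagonal, with blocks `μ_k A_k^i`. -/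
noncomputable def directSum {d r : ℕ} {D : Fin r → ℕ} (μ : Fin r → ℝ)
    (C : ∀ k, Tensor d (Fin (D k))) : Tensor d (Σ k, Fin (D k)) :=
  fun i => Matrix.blockDiagonal' fun k => (μ k : ℂ) • C k i

/-- `⨁ k, μ_k C_k` is a canonical form of `A`: the weights `μ_k` are positive, the blocks `C_k`
are normal, and `⨁ k, μ_k C_k` generates the same matrix product vectors as `A`.
A tensor that is itself in canonical form is the case `A = ⨁ k, μ_k C_k`. -/
structure IsCanonicalFormOf {d r : ℕ} {D : Fin r → ℕ} (μ : Fin r → ℝ)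
    (C : ∀ k, Tensor d (Fin (D k)))
    {n : Type*} [Fintype n] [DecidableEq n] (A : Tensor d n) : Prop where
  weight_pos : ∀ k, 0 < μ k
  normal : ∀ k, IsNormal (C k)
  sameMPV : SameMPV A (directSum μ C)

/-- `B = e^{iφ} X A X⁻¹` for a phase `φ` and a non-singular matrix `X`, whose two-sided inverse
is `Y`. Such an `X` exists only if the bond dimensions of `A` and `B` are equal. -/
def Related {d : ℕ} {m n : Type*} [Fintype m] [DecidableEq m] [Fintype n] [DecidableEq n]
    (B : Tensor d m) (A : Tensor d n) : Prop :=
  ∃ (φ : ℝ) (X : Matrix m n ℂ) (Y : Matrix n m ℂ), X * Y = 1 ∧ Y * X = 1 ∧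
    ∀ i, B i = Complex.exp (φ * Complex.I) • (X * A i * Y)

/-- The tensors `B_1, …, B_g` form a basis of normal tensors for `A`. -/
structure IsBasisOfNormalTensors {d g : ℕ} {D : Fin g → ℕ} (B : ∀ j, Tensor d (Fin (D j)))
    {n : Type*} [Fintype n] [DecidableEq n] (A : Tensor d n) : Prop where
  normal : ∀ j, IsNormal (B j)
  mem_span : ∀ N : ℕ, 1 ≤ N → mpv A N ∈ Submodule.span ℂ (Set.range fun j => mpv (B j) N)
  linearIndependent : ∃ N₀ : ℕ, ∀ N : ℕ, N₀ < N → LinearIndependent ℂ fun j => mpv (B j) N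

end MPV

/-!
Overlaps of matrix product vectors are traces of powers of mixed transfer operators
(`MPV.sum_mpv_mul_star_mpv`): `⟨V(B), V(A)⟩ = tr (E_{AB}^N)` with `E_{AB}(X) = ∑ i, A^i X (B^i)†`.
For a normal tensor `tr (E_{AA}^N) → 1` (`MPV.IsPrimitive.tendsto_trace_pow`). For two normal
tensors, an eigenvalue of `E_{AB}` of modulus at least `1` forces, by a Cauchy–Schwarz type
argument in a weighted Hilbert–Schmidt form, an invertible intertwiner `A^i Z = e^{iφ} Z B^i`
(`MPV.related_of_hasEigenvalue`); so unrelated normal tensors have `tr (E_{AB}^N) → 0`. Hence the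
Gram matrix of pairwise unrelated normal tensors tends to the identity, and their vectors are
linearly independent on long chains (`MPV.eventually_linearIndependent_mpv`).

This gives sufficiency of the two conditions, because related tensors generate proportional
vectors. Minimality is necessary for the same reason. For necessity of the first condition
(`MPV.IsCanonicalFormOf.exists_related`), write both `|V(A)⟩ = ∑ k, μ_k^N |V(C_k)⟩` and its
expansion in the basis through representatives of all gauge classes occurring among the basis
tensors and the blocks. A class containing blocks but no basis tensor has coefficient
`∑ k, (μ_k e^{iφ_k})^N`, and a nonempty power sum of nonzero numbers is nonzero for arbitrarily
large `N` (`MPV.exists_sum_pow_ne_zero`), contradicting linear independence.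
-/

namespace MPV

open Filter Topology
open scoped Matrix

/-! ### Powers of endomorphisms and power sums -/

/-- Gelfand's formula, applied to the matrix of `T`: the powers of `T` tend to `0` as soon as all
eigenvalues lie in the open unit disc. -/
theorem tendsto_trace_pow_zero {V : Type*} [AddCommGroup V] [Module ℂ V] [FiniteDimensional ℂ V]
    (T : Module.End ℂ V) (hT : ∀ z : ℂ, T.HasEigenvalue z → ‖z‖ < 1) :
    Tendsto (fun N : ℕ => LinearMap.trace ℂ V (T ^ N)) atTop (𝓝 0) := by
  rcases subsingleton_or_nontrivial V with hV | hV
  · refine tendsto_const_nhds.congr fun N => ?_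
    rw [Subsingleton.elim (T ^ N) 0, map_zero]
  let b := Module.finBasis ℂ V
  let : NormedRing (Matrix (Fin (Module.finrank ℂ V)) (Fin (Module.finrank ℂ V)) ℂ) :=
    Matrix.linftyOpNormedRing
  let : NormedAlgebra ℂ (Matrix (Fin (Module.finrank ℂ V)) (Fin (Module.finrank ℂ V)) ℂ) :=
    Matrix.linftyOpNormedAlgebra
  have : Nonempty (Fin (Module.finrank ℂ V)) := ⟨⟨0, Module.finrank_pos⟩⟩
  let M := LinearMap.toMatrixAlgEquiv b T
  have hspec : spectralRadius ℂ M < (1 : NNReal) := by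
    refine spectrum.spectralRadius_lt_of_forall_lt M fun z hz => ?_
    rw [AlgEquiv.spectrum_eq (LinearMap.toMatrixAlgEquiv b) T,
      ← Module.End.hasEigenvalue_iff_mem_spectrum] at hz
    exact hT z hz
  obtain ⟨r, hr, hr1⟩ := ENNReal.lt_iff_exists_nnreal_btwn.1 hspec
  have hr1 : r < 1 := by exact_mod_cast hr1
  have hev := (spectrum.pow_nnnorm_pow_one_div_tendsto_nhds_spectralRadius M).eventually_lt_const hr
  have hpow : Tendsto (fun N : ℕ => M ^ N) atTop (𝓝 0) := by
    refine squeeze_zero_norm' (a := fun N : ℕ => (r : ℝ) ^ N) ?_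
      (tendsto_pow_atTop_nhds_zero_of_lt_one r.2 (by exact_mod_cast hr1))
    filter_upwards [hev, eventually_ge_atTop 1] with N hN hN1
    have hN0 : (0 : ℝ) < N := by exact_mod_cast hN1
    have h := ENNReal.rpow_le_rpow hN.le hN0.le
    rw [← ENNReal.rpow_mul, one_div, inv_mul_cancel₀ hN0.ne', ENNReal.rpow_one,
      ENNReal.rpow_natCast] at h
    have h' : ‖M ^ N‖₊ ≤ r ^ N := by exact_mod_cast h
    exact_mod_cast h'
  have htr : Continuous (Matrix.trace :
      Matrix (Fin (Module.finrank ℂ V)) (Fin (Module.finrank ℂ V)) ℂ → ℂ) :=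
    LinearMap.continuous_of_finiteDimensional (Matrix.traceLinearMap _ ℂ ℂ)
  have h := (htr.tendsto 0).comp hpow
  rw [Matrix.trace_zero] at h
  refine h.congr fun N => ?_
  rw [LinearMap.trace_eq_matrix_trace ℂ b, Function.comp_apply, ← map_pow]
  rfl

/-- A nonempty power sum of nonzero numbers does not vanish for all large exponents. -/
theorem exists_sum_pow_ne_zero {ι : Type*} (s : Finset ι) (hs : s.Nonempty) (z : ι → ℂ)
    (hz : ∀ k ∈ s, z k ≠ 0) (N₀ : ℕ) : ∃ N, N₀ < N ∧ ∑ k ∈ s, z k ^ N ≠ 0 := by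
  classical
  by_contra! h
  -- Interpolation turns a combination of the vanishing power sums into the number of summands.
  let p := Lagrange.interpolate (s.image z) id fun w => (w ^ (N₀ + 1))⁻¹
  have hp : ∀ k ∈ s, p.eval (z k) * z k ^ (N₀ + 1) = 1 := fun k hk => by
    have := Lagrange.eval_interpolate_at_node (s := s.image z) (v := id)
      (fun w => (w ^ (N₀ + 1))⁻¹) Function.injective_id.injOn (Finset.mem_image_of_mem z hk)
    rw [id] at this
    rw [this, inv_mul_cancel₀ (pow_ne_zero _ (hz k hk))]
  have h1 : ∑ k ∈ s, p.eval (z k) * z k ^ (N₀ + 1) = 0 := by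
    simp_rw [Polynomial.eval_eq_sum_range, Finset.sum_mul]
    rw [Finset.sum_comm]
    refine Finset.sum_eq_zero fun i _ => ?_
    simp_rw [mul_assoc, ← pow_add, ← Finset.mul_sum]
    rw [h _ (by omega), mul_zero]
  rw [Finset.sum_congr rfl hp] at h1
  simp [hs.ne_empty] at h1

/-! ### The weighted Hilbert–Schmidt form -/

section WeightedForm

variable {m n : Type*} [Fintype m] [DecidableEq m] [Fintype n] [DecidableEq n]

open scoped MatrixOrder in
/-- `tr (σ W ρ W†)` is positive definite in `W`, being `‖s W r‖²` with `σ = s† s`, `ρ = r r†`. -/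
theorem trace_weighted_nonneg {σ : Matrix m m ℂ} {ρ : Matrix n n ℂ} (hσ : σ.PosDef)
    (hρ : ρ.PosDef) (W : Matrix m n ℂ) :
    0 ≤ (σ * W * ρ * Wᴴ).trace ∧ ((σ * W * ρ * Wᴴ).trace = 0 → W = 0) := by
  obtain ⟨s, hs⟩ := CStarAlgebra.nonneg_iff_eq_star_mul_self.mp hσ.posSemidef.nonneg
  obtain ⟨r, hr⟩ := CStarAlgebra.nonneg_iff_eq_mul_star_self.mp hρ.posSemidef.nonneg
  rw [Matrix.star_eq_conjTranspose] at hs hr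
  have key : (σ * W * ρ * Wᴴ).trace = ((s * W * r) * (s * W * r)ᴴ).trace := by
    rw [hs, hr, Matrix.conjTranspose_mul, Matrix.conjTranspose_mul,
      show sᴴ * s * W * (r * rᴴ) * Wᴴ = sᴴ * (s * W * r * (rᴴ * Wᴴ)) by
        simp only [Matrix.mul_assoc], Matrix.trace_mul_comm]
    simp only [Matrix.mul_assoc]
  refine ⟨key ▸ (Matrix.posSemidef_self_mul_conjTranspose _).trace_nonneg, fun h => ?_⟩
  rw [key, Matrix.trace_mul_conjTranspose_self_eq_zero_iff] at h
  have h2 : σ * W * ρ = 0 := by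
    rw [hs, hr, show sᴴ * s * W * (r * rᴴ) = sᴴ * (s * W * r) * rᴴ by
      simp only [Matrix.mul_assoc], h, Matrix.mul_zero, Matrix.zero_mul]
  have hσu := (Matrix.isUnit_iff_isUnit_det _).1 hσ.isUnit
  have hρu := (Matrix.isUnit_iff_isUnit_det _).1 hρ.isUnit
  calc W = σ⁻¹ * (σ * W * ρ) * ρ⁻¹ := by
        rw [Matrix.mul_assoc σ⁻¹, Matrix.mul_nonsing_inv_cancel_right _ _ hρu,
          Matrix.nonsing_inv_mul_cancel_left _ _ hσu]
    _ = 0 := by rw [h2, Matrix.mul_zero, Matrix.zero_mul]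

end WeightedForm

/-! ### Mixed transfer operators -/

section Mixed

variable {d : ℕ} {m n : Type*} [Fintype m] [Fintype n]

/-- The mixed transfer operator `X ↦ ∑ i, A^i X (B^i)†` of two tensors. -/
def mixedTransferOp (A : Tensor d m) (B : Tensor d n) : Module.End ℂ (Matrix m n ℂ) where
  toFun X := ∑ i, A i * X * (B i)ᴴ
  map_add' X Y := by simp [Matrix.mul_add, Matrix.add_mul, Finset.sum_add_distrib]
  map_smul' c X := by simp [Finset.smul_sum]

theorem mixedTransferOp_apply (A : Tensor d m) (B : Tensor d n) (X : Matrix m n ℂ) :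
    mixedTransferOp A B X = ∑ i, A i * X * (B i)ᴴ := rfl

theorem mixedTransferOp_self (A : Tensor d n) : mixedTransferOp A A = transferOp A := rfl

variable [DecidableEq m] [DecidableEq n]

theorem mixedTransferOp_pow_apply (A : Tensor d m) (B : Tensor d n) (N : ℕ) (X : Matrix m n ℂ) :
    (mixedTransferOp A B ^ N) X =
      ∑ s : Fin N → Fin d, (List.ofFn fun k => A (s k)).prod * X *
        ((List.ofFn fun k => B (s k)).prod)ᴴ := by
  induction N with
  | zero => simp
  | succ N ih =>
    rw [pow_succ', Module.End.mul_apply, ih, mixedTransferOp_apply,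
      ← (Fin.consEquiv fun _ : Fin (N + 1) => Fin d).sum_comp, Fintype.sum_prod_type]
    refine Finset.sum_congr rfl fun i _ => ?_
    rw [Matrix.mul_sum, Matrix.sum_mul]
    refine Finset.sum_congr rfl fun s _ => ?_
    simp [Fin.consEquiv, List.ofFn_succ, Matrix.conjTranspose_mul, Matrix.mul_assoc]

theorem trace_mulLeft_mulRight (P : Matrix m m ℂ) (Q : Matrix n n ℂ)
    (f : Module.End ℂ (Matrix m n ℂ))
    (hf : ∀ X, f X = P * X * Q) : LinearMap.trace ℂ _ f = P.trace * Q.trace := by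
  rw [LinearMap.trace_eq_matrix_trace ℂ (Matrix.stdBasis ℂ m n), Matrix.trace,
    Fintype.sum_prod_type, Matrix.trace, Matrix.trace, Finset.sum_mul_sum]
  refine Finset.sum_congr rfl fun i _ => Finset.sum_congr rfl fun j _ => ?_
  rw [Matrix.diag_apply, LinearMap.toMatrix_apply, Matrix.stdBasis_eq_single, hf]
  have : ∀ X : Matrix m n ℂ, (Matrix.stdBasis ℂ m n).repr X (i, j) = X i j := fun X => rfl
  rw [this, Matrix.mul_apply, Finset.sum_eq_single j]
  · simp
  · intro k _ hk
    simp [Matrix.mul_single_apply_of_ne _ _ _ _ _ hk]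
  · simp

/-- Overlaps of matrix product vectors are traces of powers of the mixed transfer operator. -/
theorem sum_mpv_mul_star_mpv (A : Tensor d m) (B : Tensor d n) (N : ℕ) :
    ∑ s, mpv A N s * star (mpv B N s) = LinearMap.trace ℂ _ (mixedTransferOp A B ^ N) := by
  let f : (Fin N → Fin d) → Module.End ℂ (Matrix m n ℂ) := fun s =>
    { toFun := fun X => (List.ofFn fun k => A (s k)).prod * X *
        ((List.ofFn fun k => B (s k)).prod)ᴴ
      map_add' := fun X Y => by rw [Matrix.mul_add, Matrix.add_mul]
      map_smul' := fun c X => by simp }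
  have : mixedTransferOp A B ^ N = ∑ s, f s := by
    ext1 X
    rw [mixedTransferOp_pow_apply, LinearMap.sum_apply]
    rfl
  rw [this, map_sum]
  refine Finset.sum_congr rfl fun s _ => ?_
  rw [trace_mulLeft_mulRight _ _ (f s) fun X => rfl, Matrix.trace_conjTranspose]
  rfl

end Mixed

/-! ### Spectral consequences of normality -/

section Normal

variable {d : ℕ} {n : Type*} [Fintype n] [DecidableEq n]

theorem IsPrimitive.nonempty {E : Module.End ℂ (Matrix n n ℂ)} (hE : IsPrimitive E) :
    Nonempty n := by
  by_contra h
  rw [not_nonempty_iff] at h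
  have h1 := hE.nondegenerate
  rw [Module.finrank_zero_of_subsingleton] at h1
  exact zero_ne_one h1

theorem IsPrimitive.norm_le_one {E : Module.End ℂ (Matrix n n ℂ)} (hE : IsPrimitive E) {z : ℂ}
    (hz : E.HasEigenvalue z) : ‖z‖ ≤ 1 := by
  have h : (‖z‖₊ : ENNReal) ≤ spectralRadius ℂ E :=
    le_iSup₂ (f := fun (k : ℂ) (_ : k ∈ spectrum ℂ E) => (‖k‖₊ : ENNReal)) z hz.mem_spectrum
  rw [hE.spectralRadius_eq_one] at h
  exact_mod_cast h

theorem IsPrimitive.eq_smul_of_fixed {E : Module.End ℂ (Matrix n n ℂ)} (hE : IsPrimitive E)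
    {ρ X : Matrix n n ℂ} (hρ : ρ ≠ 0) (hEρ : E ρ = ρ) (hX : E X = X) : ∃ c : ℂ, X = c • ρ := by
  have hmem : ∀ Y, E Y = Y → Y ∈ E.eigenspace 1 := fun Y hY => by
    rw [Module.End.mem_eigenspace_iff, hY, one_smul]
  obtain ⟨c, hc⟩ := (finrank_eq_one_iff_of_nonzero' (⟨ρ, hmem ρ hEρ⟩ : E.eigenspace 1)
    (fun h => hρ (congrArg Subtype.val h))).1 hE.nondegenerate ⟨X, hmem X hX⟩
  exact ⟨c, (congrArg Subtype.val hc).symm⟩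

theorem IsPrimitive.ne_zero_of_posDef {E : Module.End ℂ (Matrix n n ℂ)} (hE : IsPrimitive E)
    {ρ : Matrix n n ℂ} (hρ : ρ.PosDef) : ρ ≠ 0 := by
  have := hE.nonempty
  exact hρ.isUnit.ne_zero

/-- Splitting off the rank-one projection `P = |ρ⟩⟨σ|` onto the fixed point leaves eigenvalues
in the open unit disc, so the trace of `E ^ N` tends to `tr P = 1`. In particular the algebraic
multiplicity of the eigenvalue `1` never enters. -/
theorem IsPrimitive.tendsto_trace_pow {E : Module.End ℂ (Matrix n n ℂ)} (hE : IsPrimitive E) :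
    Tendsto (fun N : ℕ => LinearMap.trace ℂ _ (E ^ N)) atTop (𝓝 1) := by
  have := hE.nonempty
  obtain ⟨ρ, hρ, hEρ⟩ := hE.right_eigenvector
  obtain ⟨σ, hσ, hEσ⟩ := hE.left_eigenvector
  have hc : (σ * ρ).trace ≠ 0 := fun h => by
    have := (trace_weighted_nonneg hσ hρ (1 : Matrix n n ℂ)).2 (by simpa using h)
    exact one_ne_zero this
  let τ : Matrix n n ℂ →ₗ[ℂ] ℂ :=
    (σ * ρ).trace⁻¹ • (Matrix.traceLinearMap n ℂ ℂ ∘ₗ LinearMap.mulLeft ℂ σ)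
  have hτ : ∀ X, τ X = (σ * ρ).trace⁻¹ * (σ * X).trace := fun X => rfl
  have hτE : ∀ X, τ (E X) = τ X := fun X => by rw [hτ, hτ, hEσ]
  have hτρ : τ ρ = 1 := by rw [hτ, inv_mul_cancel₀ hc]
  let P : Module.End ℂ (Matrix n n ℂ) := τ.smulRight ρ
  have hP : ∀ X, P X = τ X • ρ := fun X => rfl
  have hEP : E * P = P := by ext1 X; simp [hP, hEρ]
  have hPE : P * E = P := by ext1 X; simp [hP, hτE]
  have hPP : P * P = P := by ext1 X; simp [hP, hτρ]
  have hpowP : ∀ N : ℕ, P * E ^ N = P := fun N => by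
    induction N with
    | zero => rw [pow_zero, mul_one]
    | succ N ih => rw [pow_succ, ← mul_assoc, ih, hPE]
  have hpow : ∀ N : ℕ, (E - P) ^ (N + 1) = E ^ (N + 1) - P := fun N => by
    induction N with
    | zero => simp
    | succ N ih =>
      rw [pow_succ', ih, sub_mul, mul_sub, mul_sub, hpowP, hEP, hPP, ← pow_succ']
      abel
  have hsmall : ∀ z : ℂ, (E - P).HasEigenvalue z → ‖z‖ < 1 := by
    intro z hz
    by_contra! hz1
    have hz0 : z ≠ 0 := fun h => by rw [h, norm_zero] at hz1; linarith
    obtain ⟨X, hX⟩ := hz.exists_hasEigenvector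
    have hX0 : X ≠ 0 := hX.2
    have hXz : E X - τ X • ρ = z • X := hX.apply_eq_smul
    have hτX : τ X = 0 := by
      have h := congrArg τ hXz
      rw [map_sub, map_smul, map_smul, hτE, hτρ, smul_eq_mul, mul_one, sub_self] at h
      exact (smul_eq_zero.1 h.symm).resolve_left hz0
    rw [hτX, zero_smul, sub_zero] at hXz
    have hEz : E.HasEigenvalue z :=
      Module.End.hasEigenvalue_of_hasEigenvector
        (Module.End.hasEigenvector_iff.2 ⟨Module.End.mem_eigenspace_iff.2 hXz, hX0⟩)
    have hz1 := hE.eigenvalue_eq_one z hEz (le_antisymm (hE.norm_le_one hEz) hz1)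
    rw [hz1, one_smul] at hXz
    obtain ⟨c, rfl⟩ := hE.eq_smul_of_fixed (hE.ne_zero_of_posDef hρ) hEρ hXz
    rw [map_smul, hτρ, smul_eq_mul, mul_one] at hτX
    exact hX0 (by rw [hτX, zero_smul])
  have htrP : LinearMap.trace ℂ _ P = 1 := by rw [LinearMap.trace_smulRight, hτρ]
  have h := (tendsto_trace_pow_zero (E - P) hsmall).add_const 1
  rw [zero_add] at h
  refine h.congr' ?_
  filter_upwards [eventually_ge_atTop 1] with N hN
  obtain ⟨N, rfl⟩ := Nat.exists_eq_add_of_le' hN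
  rw [hpow, map_sub, htrP, sub_add_cancel]

end Normal

/-! ### Peripheral eigenvectors are gauge transformations -/

theorem card_le_card_of_mul_eq_one {m n : Type*} [Fintype m] [DecidableEq m] [Fintype n]
    {Z : Matrix m n ℂ} {Y : Matrix n m ℂ} (h : Z * Y = 1) : Fintype.card m ≤ Fintype.card n :=
  calc Fintype.card m = (Z * Y).rank := by rw [h, Matrix.rank_one]
    _ ≤ Z.rank := Matrix.rank_mul_le_left Z Y
    _ ≤ Fintype.card n := Z.rank_le_card_width

section Intertwiner

variable {d : ℕ} {m n : Type*} [Fintype m] [DecidableEq m] [Fintype n] [DecidableEq n]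

/-- An eigenvector `Z ρ` of the mixed transfer operator with `|l| ≥ 1` yields an intertwiner `Z`:
the sum over `i` of the weighted norms of `A^i Z - l Z B^i` evaluates to
`(1 - |l|²) tr (σ Z ρ Z†) ≤ 0`. -/
theorem intertwiner_of_eigenvector {A : Tensor d m} {B : Tensor d n} {σ : Matrix m m ℂ}
    {ρ : Matrix n n ℂ} (hσ : σ.PosDef) (hρ : ρ.PosDef)
    (hA : ∀ X, (σ * transferOp A X).trace = (σ * X).trace) (hB : transferOp B ρ = ρ)
    {Z : Matrix m n ℂ} (hZ : Z ≠ 0) {l : ℂ} (hl : 1 ≤ ‖l‖)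
    (hZl : mixedTransferOp A B (Z * ρ) = l • (Z * ρ)) :
    ‖l‖ = 1 ∧ ∀ i, A i * Z = l • (Z * B i) := by
  set t : ℂ := (σ * Z * ρ * Zᴴ).trace with ht
  obtain ⟨ht0, htZ⟩ := trace_weighted_nonneg hσ hρ Z
  rw [mixedTransferOp_apply] at hZl
  have hZl' : ∑ i, B i * ρ * Zᴴ * (A i)ᴴ = star l • (ρ * Zᴴ) := by
    have h := congrArg Matrix.conjTranspose hZl
    rw [Matrix.conjTranspose_sum, Matrix.conjTranspose_smul, Matrix.conjTranspose_mul,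
      hρ.isHermitian.eq] at h
    rw [← h]
    refine Finset.sum_congr rfl fun i _ => ?_
    simp only [Matrix.conjTranspose_mul, Matrix.conjTranspose_conjTranspose, hρ.isHermitian.eq,
      Matrix.mul_assoc]
  have hBρ : ∑ i, B i * ρ * (B i)ᴴ = ρ := hB
  have t1 : ∑ i, (σ * (A i * Z) * ρ * (A i * Z)ᴴ).trace = t := by
    have h := hA (Z * ρ * Zᴴ)
    rw [← mixedTransferOp_self, mixedTransferOp_apply, Matrix.mul_sum, Matrix.trace_sum] at h
    rw [ht, show σ * Z * ρ * Zᴴ = σ * (Z * ρ * Zᴴ) by simp only [Matrix.mul_assoc], ← h]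
    simp only [Matrix.conjTranspose_mul, Matrix.mul_assoc]
  have t2 : ∑ i, (σ * (A i * Z) * ρ * (Z * B i)ᴴ).trace = l * t := by
    rw [ht, ← smul_eq_mul, ← Matrix.trace_smul, ← Matrix.trace_sum,
      show l • (σ * Z * ρ * Zᴴ) = σ * (l • (Z * ρ)) * Zᴴ by
        simp [Matrix.mul_assoc], ← hZl, Matrix.mul_sum, Matrix.sum_mul]
    simp only [Matrix.conjTranspose_mul, Matrix.mul_assoc]
  have t3 : ∑ i, (σ * (Z * B i) * ρ * (A i * Z)ᴴ).trace = star l * t := by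
    rw [ht, ← smul_eq_mul, ← Matrix.trace_smul, ← Matrix.trace_sum,
      show star l • (σ * Z * ρ * Zᴴ) = σ * Z * (star l • (ρ * Zᴴ)) by
        simp [Matrix.mul_assoc], ← hZl', Matrix.mul_sum]
    simp only [Matrix.conjTranspose_mul, Matrix.mul_assoc]
  have t4 : ∑ i, (σ * (Z * B i) * ρ * (Z * B i)ᴴ).trace = t := by
    rw [ht, ← Matrix.trace_sum, show σ * Z * ρ * Zᴴ = σ * Z * (∑ i, B i * ρ * (B i)ᴴ) * Zᴴ by
        rw [hBρ], Matrix.mul_sum, Matrix.sum_mul]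
    simp only [Matrix.conjTranspose_mul, Matrix.mul_assoc]
  let W : Fin d → Matrix m n ℂ := fun i => A i * Z - l • (Z * B i)
  have hsum : ∑ i, (σ * W i * ρ * (W i)ᴴ).trace = t - star l * l * t := by
    have hW : ∀ i, (σ * W i * ρ * (W i)ᴴ).trace =
        (σ * (A i * Z) * ρ * (A i * Z)ᴴ).trace - star l * (σ * (A i * Z) * ρ * (Z * B i)ᴴ).trace
        - l * (σ * (Z * B i) * ρ * (A i * Z)ᴴ).trace
        + l * star l * (σ * (Z * B i) * ρ * (Z * B i)ᴴ).trace := fun i => by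
      simp only [W, Matrix.conjTranspose_sub, Matrix.conjTranspose_smul, Matrix.mul_sub,
        Matrix.sub_mul, Matrix.mul_smul, Matrix.smul_mul, Matrix.trace_sub, Matrix.trace_smul,
        smul_eq_mul]
      ring
    simp_rw [hW, Finset.sum_add_distrib, Finset.sum_sub_distrib, ← Finset.mul_sum]
    rw [t1, t2, t3, t4]
    ring
  have hll : star l * l = ((‖l‖ ^ 2 : ℝ) : ℂ) := by
    rw [Complex.star_def, Complex.conj_mul']
    push_cast
    rfl
  have htr : t = ((t.re : ℝ) : ℂ) := by
    rw [Complex.nonneg_iff] at ht0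
    exact Complex.ext rfl (by simpa using ht0.2.symm)
  have htre : 0 < t.re := by
    rw [Complex.nonneg_iff] at ht0
    refine lt_of_le_of_ne ht0.1 fun h => hZ (htZ ?_)
    rw [← ht, htr, ← h, Complex.ofReal_zero]
  have hW0 : ∀ i, 0 ≤ (σ * W i * ρ * (W i)ᴴ).trace := fun i =>
    (trace_weighted_nonneg hσ hρ (W i)).1
  have hsum' : ∑ i, (σ * W i * ρ * (W i)ᴴ).trace = (((1 - ‖l‖ ^ 2) * t.re : ℝ) : ℂ) := by
    rw [hsum, hll, htr]
    push_cast
    rw [Complex.ofReal_re]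
    ring
  have hnn := Finset.sum_nonneg fun i (_ : i ∈ Finset.univ) => hW0 i
  rw [hsum', Complex.zero_le_real] at hnn
  have hl1 : ‖l‖ = 1 := by
    refine le_antisymm ?_ hl
    have := nonneg_of_mul_nonneg_left hnn htre
    nlinarith
  refine ⟨hl1, fun i => ?_⟩
  rw [hl1, one_pow, sub_self, zero_mul, Complex.ofReal_zero,
    Finset.sum_eq_zero_iff_of_nonneg fun i _ => hW0 i] at hsum'
  exact sub_eq_zero.1 ((trace_weighted_nonneg hσ hρ (W i)).2 (hsum' i (Finset.mem_univ i)))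

/-- If `Z ≠ 0` intertwines `A` with `l B` and `|l| = 1`, then `Z ρ Z†` is a fixed point for `A`,
hence of full rank, so `Z` is surjective. -/
theorem exists_right_inverse_of_intertwiner {A : Tensor d m} {B : Tensor d n} (hA : IsNormal A)
    {ρ : Matrix n n ℂ} (hρ : ρ.PosDef) (hB : transferOp B ρ = ρ) {Z : Matrix m n ℂ} (hZ : Z ≠ 0)
    {l : ℂ} (hl : ‖l‖ = 1) (hZl : ∀ i, A i * Z = l • (Z * B i)) :
    ∃ Y : Matrix n m ℂ, Z * Y = 1 := by
  obtain ⟨ρ', hρ', hAρ'⟩ := hA.right_eigenvector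
  have hBρ : ∑ i, B i * ρ * (B i)ᴴ = ρ := hB
  have hfix : transferOp A (Z * ρ * Zᴴ) = Z * ρ * Zᴴ := by
    rw [← mixedTransferOp_self, mixedTransferOp_apply]
    calc ∑ i, A i * (Z * ρ * Zᴴ) * (A i)ᴴ = ∑ i, (A i * Z) * ρ * (A i * Z)ᴴ := by
          simp only [Matrix.conjTranspose_mul, Matrix.mul_assoc]
      _ = ∑ i, Z * (B i * ρ * (B i)ᴴ) * Zᴴ := by
          refine Finset.sum_congr rfl fun i _ => ?_
          have hll : (starRingEnd ℂ) l * l = 1 := by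
            rw [Complex.conj_mul', hl]; norm_num
          simp [hZl, Matrix.conjTranspose_mul, Matrix.mul_assoc, smul_smul, hll]
      _ = Z * ρ * Zᴴ := by rw [← Matrix.sum_mul, ← Matrix.mul_sum, hBρ]
  obtain ⟨c, hc⟩ := hA.eq_smul_of_fixed (hA.ne_zero_of_posDef hρ') hAρ' hfix
  have hc0 : c ≠ 0 := fun h => hZ <| (trace_weighted_nonneg Matrix.PosDef.one hρ Z).2 <| by
    rw [Matrix.one_mul, hc, h, zero_smul, Matrix.trace_zero]
  have hρu := (Matrix.isUnit_iff_isUnit_det _).1 hρ'.isUnit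
  refine ⟨c⁻¹ • (ρ * Zᴴ * ρ'⁻¹), ?_⟩
  rw [Matrix.mul_smul, ← Matrix.mul_assoc, ← Matrix.mul_assoc, hc, Matrix.smul_mul,
    Matrix.mul_nonsing_inv _ hρu, smul_smul, inv_mul_cancel₀ hc0, one_smul]

theorem exists_intertwiner {A : Tensor d m} {B : Tensor d n} (hA : IsNormal A) (hB : IsNormal B)
    {l : ℂ} (hl : 1 ≤ ‖l‖) {X : Matrix m n ℂ} (hX : X ≠ 0)
    (hXl : mixedTransferOp A B X = l • X) :
    ∃ (Z : Matrix m n ℂ) (Y : Matrix n m ℂ), ‖l‖ = 1 ∧ (∀ i, A i * Z = l • (Z * B i)) ∧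
      Z * Y = 1 := by
  obtain ⟨σ, hσ, hAσ⟩ := hA.left_eigenvector
  obtain ⟨ρ, hρ, hBρ⟩ := hB.right_eigenvector
  have hρu := (Matrix.isUnit_iff_isUnit_det _).1 hρ.isUnit
  have hXZ : X * ρ⁻¹ * ρ = X := Matrix.nonsing_inv_mul_cancel_right _ _ hρu
  have hZ : X * ρ⁻¹ ≠ 0 := fun h => hX (by rw [← hXZ, h, Matrix.zero_mul])
  obtain ⟨h1, h2⟩ := intertwiner_of_eigenvector hσ hρ hAσ hBρ hZ hl (by rw [hXZ, hXl])
  obtain ⟨Y, hY⟩ := exists_right_inverse_of_intertwiner hA hρ hBρ hZ h1 h2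
  exact ⟨_, Y, h1, h2, hY⟩

/-- The mixed transfer operator of two normal tensors has an eigenvalue outside the open unit disc
only if the tensors are related by a gauge transformation and a phase. -/
theorem related_of_hasEigenvalue {A : Tensor d m} {B : Tensor d n} (hA : IsNormal A)
    (hB : IsNormal B) {l : ℂ} (hl : (mixedTransferOp A B).HasEigenvalue l) (hl1 : 1 ≤ ‖l‖) :
    Related A B := by
  obtain ⟨X, hX⟩ := hl.exists_hasEigenvector
  have hX0 : X ≠ 0 := hX.2
  have hXl : mixedTransferOp A B X = l • X := hX.apply_eq_smul
  obtain ⟨Z, Y, hln, hZ, hZY⟩ := exists_intertwiner hA hB hl1 hX0 hXl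
  -- The adjoint eigenvector gives a surjective intertwiner in the other direction, so the bond
  -- dimensions agree and the right inverse `Y` of `Z` is two-sided.
  have hXl' : mixedTransferOp B A Xᴴ = star l • Xᴴ := by
    rw [← Matrix.conjTranspose_smul, ← hXl, mixedTransferOp_apply, mixedTransferOp_apply,
      Matrix.conjTranspose_sum]
    simp [Matrix.conjTranspose_mul, Matrix.mul_assoc]
  obtain ⟨Z', Y', -, -, hZY'⟩ := exists_intertwiner hB hA (by rwa [norm_star])
    (Matrix.conjTranspose_eq_zero.not.2 hX0) hXl'
  have hcard := le_antisymm (card_le_card_of_mul_eq_one hZY) (card_le_card_of_mul_eq_one hZY')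
  refine ⟨l.arg, Z, Y, hZY, (Matrix.mul_eq_one_comm_of_card_eq m n ℂ hcard).1 hZY, fun i => ?_⟩
  have hexp : Complex.exp (l.arg * Complex.I) = l := by
    have := Complex.norm_mul_exp_arg_mul_I l
    rwa [hln, Complex.ofReal_one, one_mul] at this
  rw [hexp, ← Matrix.smul_mul, ← hZ, Matrix.mul_assoc, hZY, Matrix.mul_one]

end Intertwiner

/-! ### Gauge equivalence -/

section Related

variable {d : ℕ} {m n p : Type*} [Fintype m] [DecidableEq m] [Fintype n] [DecidableEq n]
  [Fintype p] [DecidableEq p]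

theorem Related.refl (A : Tensor d n) : Related A A :=
  ⟨0, 1, 1, by simp, by simp, fun i => by simp⟩

theorem Related.symm {B : Tensor d m} {A : Tensor d n} (h : Related B A) : Related A B := by
  obtain ⟨φ, X, Y, hXY, hYX, h⟩ := h
  refine ⟨-φ, Y, X, hYX, hXY, fun i => ?_⟩
  rw [h i, Matrix.mul_smul, Matrix.smul_mul, smul_smul, ← Complex.exp_add,
    show Y * (X * A i * Y) * X = (Y * X) * A i * (Y * X) by simp only [Matrix.mul_assoc], hYX]
  simp

theorem Related.trans {C : Tensor d p} {B : Tensor d m} {A : Tensor d n} (h : Related C B)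
    (h' : Related B A) : Related C A := by
  obtain ⟨φ, X, Y, hXY, hYX, h⟩ := h
  obtain ⟨φ', X', Y', hXY', hYX', h'⟩ := h'
  refine ⟨φ + φ', X * X', Y' * Y, ?_, ?_, fun i => ?_⟩
  · rw [show X * X' * (Y' * Y) = X * (X' * Y') * Y by simp only [Matrix.mul_assoc], hXY',
      Matrix.mul_one, hXY]
  · rw [show Y' * Y * (X * X') = Y' * (Y * X) * X' by simp only [Matrix.mul_assoc], hYX,
      Matrix.mul_one, hYX']
  · rw [h i, h' i, Complex.ofReal_add, add_mul, Complex.exp_add, ← smul_smul]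
    simp [Matrix.mul_assoc]

/-- Related tensors generate the same vectors up to the `N`-th power of a phase. -/
theorem Related.exists_mpv_eq {B : Tensor d m} {A : Tensor d n} (h : Related B A) :
    ∃ l : ℂ, l ≠ 0 ∧ ∀ N, mpv B N = l ^ N • mpv A N := by
  obtain ⟨φ, X, Y, hXY, hYX, h⟩ := h
  refine ⟨Complex.exp (φ * Complex.I), Complex.exp_ne_zero _, fun N => ?_⟩
  have key : ∀ (N : ℕ) (s : Fin N → Fin d), (List.ofFn fun k => B (s k)).prod =
      Complex.exp (φ * Complex.I) ^ N • (X * (List.ofFn fun k => A (s k)).prod * Y) := by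
    intro N
    induction N with
    | zero => intro s; simp [hXY]
    | succ N ih =>
      intro s
      rw [List.ofFn_succ, List.ofFn_succ, List.prod_cons, List.prod_cons, ih, h, Matrix.mul_smul,
        Matrix.smul_mul, smul_smul, pow_succ]
      congr 1
      calc X * A (s 0) * Y * (X * (List.ofFn fun k : Fin N => A (s k.succ)).prod * Y)
          = X * A (s 0) * (Y * X) * (List.ofFn fun k : Fin N => A (s k.succ)).prod * Y := by
            simp only [Matrix.mul_assoc]
        _ = _ := by rw [hYX, Matrix.mul_one]; simp only [Matrix.mul_assoc]
  funext s
  rw [Pi.smul_apply, mpv, mpv, key, Matrix.trace_smul, Matrix.trace_mul_comm, ← Matrix.mul_assoc,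
    hYX, Matrix.one_mul]

end Related

/-! ### Asymptotic orthonormality of normal tensors -/

section LinearIndependence

variable {d : ℕ} {ι : Type*} [Finite ι] {D : ι → ℕ}

/-- The Gram matrix of pairwise unrelated normal tensors tends to the identity, so it is
eventually invertible. -/
theorem eventually_linearIndependent_mpv (T : ∀ i, Tensor d (Fin (D i)))
    (hT : ∀ i, IsNormal (T i)) (hrel : ∀ i j, i ≠ j → ¬ Related (T i) (T j)) :
    ∀ᶠ N in atTop, LinearIndependent ℂ fun i => mpv (T i) N := by
  classical
  have := Fintype.ofFinite ι
  let G : ℕ → Matrix ι ι ℂ := fun N => Matrix.of fun i j =>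
    ∑ s, mpv (T i) N s * star (mpv (T j) N s)
  have hG : Tendsto G atTop (𝓝 1) := by
    refine tendsto_pi_nhds.2 fun i => tendsto_pi_nhds.2 fun j => ?_
    simp only [G, Matrix.of_apply, sum_mpv_mul_star_mpv]
    by_cases hij : i = j
    · subst hij
      rw [Matrix.one_apply_eq]
      exact (hT i).tendsto_trace_pow
    · rw [Matrix.one_apply_ne hij]
      refine tendsto_trace_pow_zero _ fun z hz => ?_
      by_contra! hz1
      exact hrel i j hij (related_of_hasEigenvalue (hT i) (hT j) hz hz1)
  have hdet : Tendsto (fun N => (G N).det) atTop (𝓝 1) := by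
    have h := ((continuous_id.matrix_det :
      Continuous fun M : Matrix ι ι ℂ => M.det).tendsto 1).comp hG
    rwa [id, Matrix.det_one] at h
  filter_upwards [hdet.eventually_ne one_ne_zero] with N hN
  rw [Fintype.linearIndependent_iff]
  intro c hc
  have hcG : c ᵥ* G N = 0 := by
    funext j
    simp only [Matrix.vecMul, dotProduct, G, Matrix.of_apply, Finset.mul_sum, Pi.zero_apply]
    rw [Finset.sum_comm]
    refine Finset.sum_eq_zero fun s _ => ?_
    have := congrFun hc s
    rw [Finset.sum_apply] at this
    simp only [Pi.smul_apply, smul_eq_mul, Pi.zero_apply] at this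
    simp_rw [← mul_assoc, ← Finset.sum_mul, this, zero_mul]
  exact congrFun (Matrix.eq_zero_of_vecMul_eq_zero hN hcG)

/-- The gauge equivalence relation on the index set of a finite family of tensors, whose bond
dimensions may differ. -/
def relatedSetoid (T : ∀ i, Tensor d (Fin (D i))) : Setoid ι where
  r i j := Related (T i) (T j)
  iseqv := ⟨fun i => Related.refl (T i), fun h => h.symm, fun h h' => h.trans h'⟩

end LinearIndependence

/-! ### Vectors of a canonical form -/

theorem mpv_directSum {d r : ℕ} {D : Fin r → ℕ} (μ : Fin r → ℝ) (C : ∀ k, Tensor d (Fin (D k)))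
    (N : ℕ) : mpv (directSum μ C) N = ∑ k, (μ k : ℂ) ^ N • mpv (C k) N := by
  have key : ∀ (N : ℕ) (s : Fin N → Fin d), (List.ofFn fun k => directSum μ C (s k)).prod =
      Matrix.blockDiagonal' fun k => (μ k : ℂ) ^ N • (List.ofFn fun l => C k (s l)).prod := by
    intro N
    induction N with
    | zero =>
      intro s
      simp only [List.ofFn_zero, List.prod_nil, pow_zero, one_smul]
      exact Matrix.blockDiagonal'_one.symm
    | succ N ih =>
      intro s
      rw [List.ofFn_succ, List.prod_cons, ih, directSum, ← Matrix.blockDiagonal'_mul]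
      congr 1
      funext k
      rw [List.ofFn_succ, List.prod_cons, Matrix.smul_mul, Matrix.mul_smul, smul_smul, pow_succ']
  funext s
  rw [mpv, key, Matrix.trace_blockDiagonal', Finset.sum_apply]
  simp [mpv]

/-! ### The characterization -/

section Characterization

variable {d : ℕ} {n : Type*} [Fintype n] [DecidableEq n] {A : Tensor d n} {r : ℕ}
  {D : Fin r → ℕ} {μ : Fin r → ℝ} {C : ∀ k, Tensor d (Fin (D k))} {g : ℕ} {D' : Fin g → ℕ}
  {B : ∀ j, Tensor d (Fin (D' j))}

theorem IsCanonicalFormOf.mpv_eq (hC : IsCanonicalFormOf μ C A) {N : ℕ} (hN : 1 ≤ N) :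
    mpv A N = ∑ k, (μ k : ℂ) ^ N • mpv (C k) N := by
  rw [hC.sameMPV N hN, mpv_directSum]

theorem IsCanonicalFormOf.isBasis (hC : IsCanonicalFormOf μ C A) (hB : ∀ j, IsNormal (B j))
    (hCB : ∀ k, ∃ j, Related (C k) (B j)) (hmin : ∀ j j', j' ≠ j → ¬ Related (B j) (B j')) :
    IsBasisOfNormalTensors B A where
  normal := hB
  mem_span N hN := by
    rw [hC.mpv_eq hN]
    refine Submodule.sum_mem _ fun k _ => Submodule.smul_mem _ _ ?_
    obtain ⟨j, hj⟩ := hCB k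
    obtain ⟨l, -, hl⟩ := hj.exists_mpv_eq
    rw [hl]
    exact Submodule.smul_mem _ _ (Submodule.subset_span ⟨j, rfl⟩)
  linearIndependent := by
    obtain ⟨N₀, h⟩ := eventually_atTop.1 (eventually_linearIndependent_mpv B hB
      fun i j hij => hmin i j hij.symm)
    exact ⟨N₀, fun N hN => h N hN.le⟩

theorem IsBasisOfNormalTensors.not_related (h : IsBasisOfNormalTensors B A) {j j' : Fin g}
    (hjj' : j' ≠ j) : ¬ Related (B j) (B j') := by
  intro hrel
  obtain ⟨l, -, hl⟩ := hrel.exists_mpv_eq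
  obtain ⟨N₀, hN₀⟩ := h.linearIndependent
  have hli := (linearIndependent_iff_injective_finsuppLinearCombination).1 (hN₀ _ N₀.lt_succ_self)
  have heq : Finsupp.single j (1 : ℂ) = Finsupp.single j' (l ^ (N₀ + 1)) := hli (by
    simp [hl])
  have := DFunLike.congr_fun heq j
  rw [Finsupp.single_eq_same, Finsupp.single_eq_of_ne hjj'.symm] at this
  exact one_ne_zero this

/-- Every block of the canonical form is related to a member of the basis: otherwise, among
representatives of all classes of the `B j` and `C k`, the class of the missing block `C k` carries
the coefficient `∑ (μ e^{iφ})^N` over the blocks in that class, which does not vanish for all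
large `N`. -/
theorem IsCanonicalFormOf.exists_related (hC : IsCanonicalFormOf μ C A)
    (hB : IsBasisOfNormalTensors B A) (k₀ : Fin r) : ∃ j, Related (C k₀) (B j) := by
  classical
  by_contra! hne
  let E : Fin g ⊕ Fin r → ℕ := Sum.elim D' D
  let T : ∀ i, Tensor d (Fin (E i)) := fun i =>
    match i with
    | .inl j => B j
    | .inr k => C k
  have hTn : ∀ i, IsNormal (T i)
    | .inl j => hB.normal j
    | .inr k => hC.normal k
  let S := relatedSetoid T
  have hout : ∀ i, Related (T i) (T (⟦i⟧ : Quotient S).out) := fun i =>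
    Setoid.symm' S (Quotient.mk_out i)
  obtain ⟨N₁, hN₁⟩ := eventually_atTop.1 (eventually_linearIndependent_mpv
    (fun q : Quotient S => T q.out) (fun q => hTn _) fun q q' hqq' hrel =>
      hqq' (Quotient.out_equiv_out.1 hrel))
  choose l hl0 hl using fun i => (hout i).exists_mpv_eq
  let s : Finset (Fin r) := Finset.univ.filter fun k => (⟦.inr k⟧ : Quotient S) = ⟦.inr k₀⟧
  obtain ⟨N, hN, hsum⟩ := exists_sum_pow_ne_zero s ⟨k₀, by simp [s]⟩
    (fun k => (μ k : ℂ) * l (.inr k))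
    (fun k _ => mul_ne_zero (by exact_mod_cast (hC.weight_pos k).ne') (hl0 _)) N₁
  have hmem := hB.mem_span N (by omega)
  obtain ⟨c, hc⟩ := (Submodule.mem_span_range_iff_exists_fun ℂ).1 hmem
  rw [hC.mpv_eq (by omega)] at hc
  -- Both sides are combinations of the vectors of the representatives.
  let W : Quotient S → (Fin N → Fin d) → ℂ := fun q => mpv (T q.out) N
  have hBW : ∀ j, mpv (B j) N = l (.inl j) ^ N • W (Quotient.mk S (.inl j)) :=
    fun j => hl (.inl j) N
  have hCW : ∀ k, mpv (C k) N = l (.inr k) ^ N • W (Quotient.mk S (.inr k)) :=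
    fun k => hl (.inr k) N
  have hW : LinearIndependent ℂ W := hN₁ N hN.le
  rw [linearIndependent_iff_injective_finsuppLinearCombination] at hW
  have heq : ∑ j, Finsupp.single (⟦.inl j⟧ : Quotient S) (c j * l (.inl j) ^ N) =
      ∑ k, Finsupp.single (⟦.inr k⟧ : Quotient S) (((μ k : ℂ) * l (.inr k)) ^ N) := hW (by
    simp only [map_sum, Finsupp.linearCombination_single]
    simpa [hBW, hCW, smul_smul, mul_pow] using hc)
  have h := DFunLike.congr_fun heq ⟦.inr k₀⟧
  rw [Finsupp.finsetSum_apply, Finsupp.finsetSum_apply, Finset.sum_eq_zero] at h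
  · refine hsum (Eq.trans ?_ h.symm)
    rw [Finset.sum_filter]
    refine Finset.sum_congr rfl fun k _ => ?_
    rw [Finsupp.single_apply]
  · intro j _
    rw [Finsupp.single_apply, if_neg]
    intro hj
    exact hne j (Related.symm (Quotient.exact hj : Related (T (.inl j)) (T (.inr k₀))))

/-- One block from each class of related blocks is a basis. -/
theorem IsCanonicalFormOf.exists_isBasis (hC : IsCanonicalFormOf μ C A) :
    ∃ (g : ℕ) (D' : Fin g → ℕ) (B : ∀ j, Tensor d (Fin (D' j))),
      IsBasisOfNormalTensors B A := by
  let S := relatedSetoid C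
  obtain ⟨g, ⟨e⟩⟩ := Finite.exists_equiv_fin (Quotient S)
  refine ⟨g, fun j => D (e.symm j).out, fun j => C (e.symm j).out,
    hC.isBasis (fun j => hC.normal _) (fun k => ⟨e ⟦k⟧, ?_⟩) fun j j' hjj' hrel => hjj' ?_⟩
  · have h : Related (C k) (C (⟦k⟧ : Quotient S).out) := Setoid.symm' S (Quotient.mk_out k)
    rwa [e.symm_apply_apply]
  · exact (e.symm.injective (Quotient.out_equiv_out.1 hrel)).symm

end Characterization

end MPV

theorem proposition1 {d : ℕ} {n : Type*} [Fintype n] [DecidableEq n] (A : MPV.Tensor d n)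
    {r : ℕ} {D : Fin r → ℕ} (μ : Fin r → ℝ) (C : ∀ k, MPV.Tensor d (Fin (D k)))
    (hC : MPV.IsCanonicalFormOf μ C A) :
    (∀ (g : ℕ) (D' : Fin g → ℕ) (B : ∀ j, MPV.Tensor d (Fin (D' j))),
      (∀ j, MPV.IsNormal (B j)) →
        (MPV.IsBasisOfNormalTensors B A ↔
          (∀ k, ∃ j, MPV.Related (C k) (B j)) ∧
          (∀ j j', j' ≠ j → ¬ MPV.Related (B j) (B j')))) ∧
    (∃ (g : ℕ) (D' : Fin g → ℕ) (B : ∀ j, MPV.Tensor d (Fin (D' j))),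
      MPV.IsBasisOfNormalTensors B A) :=
  ⟨fun _ _ _ hB => ⟨fun h => ⟨hC.exists_related h, fun _ _ hjj' => h.not_related hjj'⟩,
    fun h => hC.isBasis hB h.1 h.2⟩, hC.exists_isBasis⟩
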